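/- Let $0<q<1$. Write $(a;q)_n=\prod_{i=0}^{n-1}(1-aq^i)$ and $(a;q)_\infty=\prod_{i\ge 0}(1-aq^i)$, $[n]_q=\frac{1-q^n}{1-q}$, $[n]_q!=\prod_{i=1}^n[i]_q$, and let $$e_q(t)=\sum_{n\ge 0}\frac{(t(1-q))^n}{(q;q)_n},\qquad E_q(t)=\sum_{n\ge 0}\frac{q^{n(n-1)/2}(t(1-q))^n}{(q;q)_n}.$$ The $q$-Bernoulli polynomials $B_n(z;q)$ are defined by the generating function (expanded about $t=0$) $$\frac{t\,E_q(zt)}{e_q(\frac t2)E_q(\frac t2)-1}=\sum_{n=0}^\infty B_n(z;q)\frac{t^n}{[n]_q!}.$$ Let $j^{(2)}_{1,1/2}$ be the smallest positive zero of $J^{(2)}_{1/2}(\cdot\,;q^2)$, where $$J^{(2)}_\alpha(x;q)=\frac{(q^{\alpha+1};q)_\infty}{(q;q)_\infty}\sum_{n=0}^\infty(-1)^n\frac{q^{n(\alpha+n)}(\frac x2)^{2n+\alpha}}{(q;q)_n(q^{\alpha+1};q)_n}$$ is the second Jackson $q$-Bessel function. Let $f(z)=\sum_{n=0}^\infty f_nz^n$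 $(z\in\mathbb C)$ be an entire function such that $$\lim_{n\to\infty}\sqrt[n]{\left|\frac{f_n}{\Psi_n}\right|}=\tau,\qquad \Psi_n=\frac{q^{n(n-1)/2}}{[n]_q!},\qquad 0\le\tau<\min\left\{\frac2{1-q},\frac{j^{(2)}_{1,1/2}}{1-q}\right\}.$$ Then, for every $z\in\mathbb C$, $$f(z)=\sum_{n=0}^\infty L_n(f)\,\frac{B_n(z;q)}{[n]_q!},$$ where, for every $n\ge 0$, $$L_n(f)=(1-q)^{-n}\sum_{k=n}^\infty f_k\,\frac{q^{-k(k-1)/2}\,(q;q)_k\,(-q;q)_{k-n}\,(\frac12)^{k-n}}{(q^2;q)_{k-n}},$$ and all these series converge absolutely. -/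

import Mathlib

open Filter Topology

noncomputable section

/-- The finite `q`-shifted factorial `(a;q)_n = ∏_{i<n} (1 - a q^i)`. -/
def qPoch (a q : ℝ) (n : ℕ) : ℝ :=
  ∏ i ∈ Finset.range n, (1 - a * q ^ i)

/-- The infinite `q`-shifted factorial `(a;q)_∞ = ∏_{i≥0} (1 - a q^i)` (for `|q| < 1`). -/
def qPochInf (a q : ℝ) : ℝ :=
  ∏' i : ℕ, (1 - a * q ^ i)

/-- The `q`-natural number `[n]_q = (1 - q^n)/(1 - q)`. -/
def qNat (q : ℝ) (n : ℕ) : ℝ :=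
  (1 - q ^ n) / (1 - q)

/-- The `q`-factorial `[n]_q! = [1]_q [2]_q ⋯ [n]_q`. -/
def qFact (q : ℝ) (n : ℕ) : ℝ :=
  ∏ i ∈ Finset.range n, qNat q (i + 1)

/-- The second Jackson `q`-Bessel function `J_α^{(2)}(x;q)` on the positive half-line:
`(q^{α+1};q)_∞/(q;q)_∞ * ∑_n (-1)^n q^{n(α+n)} (x/2)^{2n+α} / ((q;q)_n (q^{α+1};q)_n)`. -/
def jacksonBesselTwo (α q x : ℝ) : ℝ :=
  qPochInf (q ^ (α + 1)) q / qPochInf q q *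
    ∑' n : ℕ, (-1 : ℝ) ^ n * (q ^ ((n : ℝ) * (α + n)) * (x / 2) ^ (2 * (n : ℝ) + α)) /
      (qPoch q q n * qPoch (q ^ (α + 1)) q n)

/-- `j^{(2)}_{1,α}`: the smallest positive zero of `J_α^{(2)}(·;q²)`. -/
def firstZeroBesselTwo (α q : ℝ) : ℝ :=
  sInf {x : ℝ | 0 < x ∧ jacksonBesselTwo α (q ^ 2) x = 0}

/-- The Taylor series of `e_q(t) = ∑_n (t(1-q))^n/(q;q)_n`. -/
def qExpSmall (q : ℝ) : PowerSeries ℂ :=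
  PowerSeries.mk fun n => (((1 - q) ^ n / qPoch q q n : ℝ) : ℂ)

/-- The Taylor series of `E_q(t) = ∑_n q^{n(n-1)/2} (t(1-q))^n/(q;q)_n`. -/
def qExpBig (q : ℝ) : PowerSeries ℂ :=
  PowerSeries.mk fun n => ((q ^ (n * (n - 1) / 2) * (1 - q) ^ n / qPoch q q n : ℝ) : ℂ)

/-- The Taylor series of `e_q(t/2) E_q(t/2) - 1`. -/
def qBernoulliDenom (q : ℝ) : PowerSeries ℂ :=
  PowerSeries.rescale (1 / 2 : ℂ) (qExpSmall q) * PowerSeries.rescale (1 / 2 : ℂ) (qExpBig q) - 1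

/-- The Taylor series of `(e_q(t/2) E_q(t/2) - 1)/t`. -/
def qBernoulliDenomDivX (q : ℝ) : PowerSeries ℂ :=
  PowerSeries.mk fun n => PowerSeries.coeff (n + 1) (qBernoulliDenom q)

/-- The Taylor series in `t` of `t E_q(zt) / (e_q(t/2) E_q(t/2) - 1)`. -/
def qBernoulliGen (q : ℝ) (z : ℂ) : PowerSeries ℂ :=
  PowerSeries.rescale z (qExpBig q) * (qBernoulliDenomDivX q)⁻¹

/-- The `q`-Bernoulli polynomials `B_n(z;q)`, defined by the generating function
`t E_q(zt) / (e_q(t/2) E_q(t/2) - 1) = ∑_n B_n(z;q) t^n/[n]_q!`. -/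
def qBernoulli (q : ℝ) (n : ℕ) (z : ℂ) : ℂ :=
  (qFact q n : ℂ) * PowerSeries.coeff n (qBernoulliGen q z)

lemma qFact_pos {q : ℝ} (hq0 : 0 < q) (hq1 : q < 1) (n : ℕ) : 0 < qFact q n := by
  refine Finset.prod_pos fun i _ => ?_
  have h : q ^ (i + 1) < 1 := pow_lt_one₀ hq0.le hq1 (Nat.succ_ne_zero i)
  exact div_pos (by linarith) (by linarith)

lemma X_mul_qBernoulliDenomDivX (q : ℝ) :
    PowerSeries.X * qBernoulliDenomDivX q = qBernoulliDenom q := by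
  ext n
  cases n with
  | zero =>
    rw [PowerSeries.coeff_zero_X_mul]
    simp [-PowerSeries.coeff_zero_eq_constantCoeff, qBernoulliDenom, qExpSmall, qExpBig, qPoch,
      PowerSeries.coeff_mul]
  | succ n => simp [PowerSeries.coeff_succ_X_mul, qBernoulliDenomDivX]

lemma constantCoeff_qBernoulliDenomDivX {q : ℝ} (hq1 : q < 1) :
    PowerSeries.constantCoeff (qBernoulliDenomDivX q) = 1 := by
  have h : (1 - (q : ℂ)) ≠ 0 := by
    rw [sub_ne_zero]; exact_mod_cast hq1.ne'
  rw [← PowerSeries.coeff_zero_eq_constantCoeff_apply]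
  simp [qBernoulliDenomDivX, qBernoulliDenom, qExpSmall, qExpBig, qPoch, PowerSeries.coeff_mul,
    Finset.Nat.antidiagonal_succ, PowerSeries.coeff_one]
  field_simp
  norm_num

/-- The defining identity of the `q`-Bernoulli polynomials, cleared of its denominator. -/
lemma qBernoulli_generating {q : ℝ} (hq0 : 0 < q) (hq1 : q < 1) (z : ℂ) :
    (PowerSeries.mk fun n => qBernoulli q n z / (qFact q n : ℂ)) * qBernoulliDenom q =
      PowerSeries.X * PowerSeries.rescale z (qExpBig q) := by
  have h1 : (PowerSeries.mk fun n => qBernoulli q n z / (qFact q n : ℂ)) = qBernoulliGen q z := by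
    ext n
    have h : (qFact q n : ℂ) ≠ 0 := by exact_mod_cast (qFact_pos hq0 hq1 n).ne'
    simp only [PowerSeries.coeff_mk, qBernoulli]
    field_simp
  have h2 : (qBernoulliDenomDivX q)⁻¹ * qBernoulliDenomDivX q = 1 :=
    PowerSeries.inv_mul_cancel _ (by rw [constantCoeff_qBernoulliDenomDivX hq1]; exact one_ne_zero)
  rw [h1, ← X_mul_qBernoulliDenomDivX, qBernoulliGen]
  calc _ = PowerSeries.X * PowerSeries.rescale z (qExpBig q) *
        ((qBernoulliDenomDivX q)⁻¹ * qBernoulliDenomDivX q) := by ring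
    _ = _ := by rw [h2, mul_one]

/-- `Ψ_n = q^{n(n-1)/2}/[n]_q!`. -/
def qPsi (q : ℝ) (n : ℕ) : ℝ :=
  q ^ (n * (n - 1) / 2) / qFact q n

/-- The summand with index `k = n + m` of the series for `L_n(f)`, where `f(z) = ∑_k a_k z^k`:
`a_k q^{-k(k-1)/2} (q;q)_k (-q;q)_{k-n} (1/2)^{k-n} / (q²;q)_{k-n}`. -/
def qBernoulliCoeffTerm (q : ℝ) (a : ℕ → ℂ) (n m : ℕ) : ℂ :=
  a (n + m) * (((q ^ ((n + m) * (n + m - 1) / 2))⁻¹ * qPoch q q (n + m) *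
    qPoch (-q) q m * (1 / 2) ^ m / qPoch (q ^ 2) q m : ℝ) : ℂ)

/-- `L_n(f) = (1-q)^{-n} ∑_{k≥n} a_k q^{-k(k-1)/2} (q;q)_k (-q;q)_{k-n} (1/2)^{k-n} / (q²;q)_{k-n}`
for `f(z) = ∑_k a_k z^k`. -/
def qBernoulliCoeff (q : ℝ) (a : ℕ → ℂ) (n : ℕ) : ℂ :=
  ((((1 - q) ^ n)⁻¹ : ℝ) : ℂ) * ∑' m : ℕ, qBernoulliCoeffTerm q a n m

end

/-!
The umbral functional `t ^ k ↦ a k / Ψ_k` sends `E_q(zt) = ∑ Ψ_k (zt)^k` to `f z`. Writing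
`D(t) = (e_q(t/2) E_q(t/2) - 1)/t` and `G_z` for the generating function of `B_n(z;q)/[n]_q!`, one
has `E_q(zt) = G_z(t) D(t)`; applying the functional to this product and summing by powers of `G_z`
gives the expansion, since the functional sends `t ^ n D(t)` to `L_n(f)`. The growth condition gives
`a k / Ψ_k = O(ρ ^ k)`, so the rearrangement is legitimate once `D` and `G_z` converge at `ρ`.

`G_z = E_q(zt)/D(t)` converges up to the first zero of `D`. As `e_q(t) E_q(-t) = 1`, a zero `2t` of
`D` satisfies `E_q(t) = E_q(-t)`. The product `E_q(t) = ∏ (1 + (1-q) q^i t)` shows that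
`|E_q(-t)| < |E_q(t)|` for `0 < Re t`, so `t` is purely imaginary; and for `0 < s`, up to nonzero
factors, `E_q(is) - E_q(-is)` is `J^{(2)}_{1/2}(2(1-q)s; q²)`.
-/

open PowerSeries

section SeriesAtAPoint

variable {𝕜 : Type*} [NormedField 𝕜] {A B : 𝕜⟦X⟧} {c t : 𝕜}

/-- Absolute convergence of the formal power series `A` at the point `t`. -/
def ConvergesAt (A : 𝕜⟦X⟧) (t : 𝕜) : Prop :=
  Summable fun n => ‖coeff n A * t ^ n‖

/-- The sum of the formal power series `A` at the point `t`; by the convention for `∑'` it is `0`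
where the series diverges. -/
noncomputable def evalAt (A : 𝕜⟦X⟧) (t : 𝕜) : 𝕜 :=
  ∑' n, coeff n A * t ^ n

lemma ConvergesAt.hasSum [CompleteSpace 𝕜] (h : ConvergesAt A t) :
    HasSum (fun n => coeff n A * t ^ n) (evalAt A t) :=
  (Summable.of_norm h).hasSum

lemma ConvergesAt.of_norm_eq {s : 𝕜} (h : ConvergesAt A t) (hst : ‖s‖ = ‖t‖) :
    ConvergesAt A s := by
  simpa only [ConvergesAt, norm_mul, norm_pow, hst] using h

lemma evalAt_zero (A : 𝕜⟦X⟧) : evalAt A 0 = coeff 0 A := by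
  rw [evalAt, tsum_eq_single 0 fun n hn => by rw [zero_pow hn, mul_zero], pow_zero, mul_one]

lemma coeff_one_mul_pow_eq_zero {n : ℕ} (hn : n ≠ 0) (t : 𝕜) :
    coeff n (1 : 𝕜⟦X⟧) * t ^ n = 0 := by
  rw [coeff_one, if_neg hn, zero_mul]

lemma convergesAt_one (t : 𝕜) : ConvergesAt (1 : 𝕜⟦X⟧) t :=
  (hasSum_single 0 fun n hn => by rw [coeff_one_mul_pow_eq_zero hn, norm_zero]).summable

lemma evalAt_one (t : 𝕜) : evalAt (1 : 𝕜⟦X⟧) t = 1 := by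
  rw [evalAt, tsum_eq_single 0 fun n hn => coeff_one_mul_pow_eq_zero hn t, coeff_zero_one,
    pow_zero, mul_one]

lemma ConvergesAt.sub [CompleteSpace 𝕜] (hA : ConvergesAt A t) (hB : ConvergesAt B t) :
    ConvergesAt (A - B) t := by
  refine Summable.of_nonneg_of_le (fun _ => norm_nonneg _) (fun n => ?_) (Summable.add hA hB)
  rw [map_sub, sub_mul]
  exact norm_sub_le _ _

lemma evalAt_sub [CompleteSpace 𝕜] (hA : ConvergesAt A t) (hB : ConvergesAt B t) :
    evalAt (A - B) t = evalAt A t - evalAt B t := by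
  simpa only [evalAt, map_sub, sub_mul] using (hA.hasSum.sub hB.hasSum).tsum_eq

lemma evalAt_C_mul (A : 𝕜⟦X⟧) (c t : 𝕜) : evalAt (C c * A) t = c * evalAt A t := by
  simp only [evalAt, coeff_C_mul, mul_assoc, tsum_mul_left]

lemma convergesAt_X_mul : ConvergesAt (X * A) t ↔ ConvergesAt A t := by
  rcases eq_or_ne t 0 with rfl | ht
  · have (B : 𝕜⟦X⟧) : ConvergesAt B 0 :=
      (hasSum_single 0 fun n hn => by rw [zero_pow hn, mul_zero, norm_zero]).summable
    exact iff_of_true (this _) (this _)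
  · rw [ConvergesAt, ← summable_nat_add_iff 1]
    simp only [coeff_succ_X_mul, pow_succ, ← mul_assoc, norm_mul _ t]
    exact summable_mul_right_iff (norm_ne_zero_iff.2 ht)

lemma evalAt_X_mul [CompleteSpace 𝕜] (hA : ConvergesAt A t) :
    evalAt (X * A) t = t * evalAt A t := by
  rw [evalAt, (convergesAt_X_mul.2 hA).hasSum.summable.tsum_eq_zero_add, coeff_zero_X_mul,
    zero_mul, zero_add, evalAt, ← tsum_mul_left]
  refine tsum_congr fun n => ?_
  rw [coeff_succ_X_mul]
  ring

lemma coeff_mul_mul_pow (A B : 𝕜⟦X⟧) (t : 𝕜) (n : ℕ) :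
    coeff n (A * B) * t ^ n = ∑ p ∈ Finset.HasAntidiagonal.antidiagonal n,
      (coeff p.1 A * t ^ p.1) * (coeff p.2 B * t ^ p.2) := by
  rw [coeff_mul, Finset.sum_mul]
  refine Finset.sum_congr rfl fun p hp => ?_
  rw [← Finset.HasAntidiagonal.mem_antidiagonal.1 hp]
  ring

lemma ConvergesAt.mul (hA : ConvergesAt A t) (hB : ConvergesAt B t) : ConvergesAt (A * B) t := by
  simp only [ConvergesAt, coeff_mul_mul_pow]
  exact summable_norm_sum_mul_antidiagonal_of_summable_norm
    (f := fun n => coeff n A * t ^ n) (g := fun n => coeff n B * t ^ n) hA hB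

lemma evalAt_mul [CompleteSpace 𝕜] (hA : ConvergesAt A t) (hB : ConvergesAt B t) :
    evalAt (A * B) t = evalAt A t * evalAt B t := by
  simp only [evalAt, coeff_mul_mul_pow]
  exact (tsum_mul_tsum_eq_tsum_sum_antidiagonal_of_summable_norm hA hB).symm

lemma coeff_rescale_mul_pow (A : 𝕜⟦X⟧) (c t : 𝕜) (n : ℕ) :
    coeff n (rescale c A) * t ^ n = coeff n A * (c * t) ^ n := by
  rw [coeff_rescale, mul_pow]
  ring

lemma convergesAt_rescale : ConvergesAt (rescale c A) t ↔ ConvergesAt A (c * t) := by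
  simp only [ConvergesAt, coeff_rescale_mul_pow]

lemma evalAt_rescale (A : 𝕜⟦X⟧) (c t : 𝕜) : evalAt (rescale c A) t = evalAt A (c * t) := by
  simp only [evalAt, coeff_rescale_mul_pow]

lemma convergesAt_of_coeff_succ {r : ℕ → 𝕜} {l : 𝕜}
    (h : ∀ n, coeff (n + 1) A = r n * coeff n A) (hr : Tendsto r atTop (𝓝 l))
    (ht : ‖l * t‖ < 1) : ConvergesAt A t := by
  obtain ⟨s, hs, hs1⟩ := exists_between ht
  refine summable_of_ratio_norm_eventually_le hs1 ?_
  filter_upwards [(hr.mul_const t).norm.eventually_lt_const hs] with n hn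
  rw [norm_norm, norm_norm]
  calc ‖coeff (n + 1) A * t ^ (n + 1)‖ = ‖r n * t‖ * ‖coeff n A * t ^ n‖ := by
        rw [h, ← norm_mul]
        ring_nf
    _ ≤ s * ‖coeff n A * t ^ n‖ := by gcongr

lemma hasSum_evalAt_sub_evalAt_neg [CompleteSpace 𝕜] (h : ConvergesAt A t) :
    HasSum (fun k => 2 * (coeff (2 * k + 1) A * t ^ (2 * k + 1)))
      (evalAt A t - evalAt A (-t)) := by
  have hsub := h.hasSum.sub (h.of_norm_eq (norm_neg t)).hasSum
  have hinj : Function.Injective fun k : ℕ => 2 * k + 1 := fun _ _ _ => by grind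
  rw [← hinj.hasSum_iff] at hsub
  · simpa only [Function.comp_def, (odd_two_mul_add_one _).neg_pow, mul_neg, sub_neg_eq_add,
      ← two_mul] using hsub
  · intro n hn
    have heven : Even n := Nat.not_odd_iff_even.1 fun ⟨k, hk⟩ => hn ⟨k, hk.symm⟩
    rw [heven.neg_pow, sub_self]

end SeriesAtAPoint

section Holomorphic

variable {𝕜 : Type*} [DenselyNormedField 𝕜] [CompleteSpace 𝕜] {A B : 𝕜⟦X⟧} {R : ℝ}

lemma hasFPowerSeriesOnBall_evalAt (hR : 0 < R) (hA : ∀ t : 𝕜, ‖t‖ < R → ConvergesAt A t) :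
    HasFPowerSeriesOnBall (evalAt A) (.ofScalars 𝕜 fun n => coeff n A) 0 (.ofReal R) where
  r_le := by
    refine ENNReal.le_of_forall_nnreal_lt fun r hr => ?_
    obtain ⟨s, hrs, hsR⟩ := NormedField.exists_lt_norm_lt 𝕜 r.coe_nonneg
      ((ENNReal.lt_ofReal_iff_toReal_lt ENNReal.coe_ne_top).1 hr)
    refine FormalMultilinearSeries.le_radius_of_summable_norm _
      (Summable.of_nonneg_of_le (fun n => by positivity) (fun n => ?_) (hA s hsR))
    rw [FormalMultilinearSeries.ofScalars_norm, norm_mul, norm_pow]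
    gcongr
  r_pos := ENNReal.ofReal_pos.2 hR
  hasSum {t} ht := by
    rw [Metric.eball_ofReal, mem_ball_zero_iff] at ht
    simpa [FormalMultilinearSeries.ofScalars_apply_eq, mul_comm] using (hA t ht).hasSum

lemma eq_of_evalAt_eq (hR : 0 < R) (hA : ∀ t : 𝕜, ‖t‖ < R → ConvergesAt A t)
    (hB : ∀ t : 𝕜, ‖t‖ < R → ConvergesAt B t) (h : ∀ t : 𝕜, ‖t‖ < R → evalAt A t = evalAt B t) :
    A = B := by
  have hp := (hasFPowerSeriesOnBall_evalAt hR hA).hasFPowerSeriesAt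
    |>.eq_formalMultilinearSeries_of_eventually
      (hasFPowerSeriesOnBall_evalAt hR hB).hasFPowerSeriesAt
      (by filter_upwards [Metric.ball_mem_nhds 0 hR] with t ht using h t (by simpa using ht))
  ext n
  exact congrFun (FormalMultilinearSeries.ofScalars_series_injective 𝕜 𝕜 hp) n

lemma continuousAt_evalAt_zero (hR : 0 < R) (hA : ∀ t : 𝕜, ‖t‖ < R → ConvergesAt A t) :
    ContinuousAt (evalAt A) 0 :=
  (hasFPowerSeriesOnBall_evalAt hR hA).hasFPowerSeriesAt.continuousAt

lemma exists_powerSeries_of_differentiableOn {g : ℂ → ℂ}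
    (hg : DifferentiableOn ℂ g (Metric.ball 0 R)) :
    ∃ G : ℂ⟦X⟧, ∀ t : ℂ, ‖t‖ < R → ConvergesAt G t ∧ evalAt G t = g t := by
  refine ⟨.mk fun n => (n.factorial : ℂ)⁻¹ * iteratedDeriv n g 0, fun t ht => ?_⟩
  have hsum : HasSum (fun n => coeff n (.mk fun n => (n.factorial : ℂ)⁻¹ * iteratedDeriv n g 0) *
      t ^ n) (g t) := by
    simpa only [coeff_mk, sub_zero, smul_eq_mul, mul_assoc, mul_comm (t ^ _)] using
      Complex.hasSum_taylorSeries_on_ball hg (z := t) (by simpa using ht)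
  exact ⟨hsum.summable.norm, hsum.tsum_eq⟩

lemma convergesAt_inv {A : ℂ⟦X⟧} (hA : ∀ t : ℂ, ‖t‖ < R → ConvergesAt A t)
    (h0 : ∀ t : ℂ, ‖t‖ < R → evalAt A t ≠ 0) {t : ℂ} (ht : ‖t‖ < R) : ConvergesAt A⁻¹ t := by
  have hR : 0 < R := (norm_nonneg t).trans_lt ht
  have hdiff : DifferentiableOn ℂ (evalAt A) (Metric.ball 0 R) := by
    simpa only [Metric.eball_ofReal] using
      (hasFPowerSeriesOnBall_evalAt hR hA).differentiableOn
  obtain ⟨G, hG⟩ := exists_powerSeries_of_differentiableOn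
    (hdiff.inv fun s hs => h0 s (by simpa using hs))
  have hGA : G * A = 1 :=
    eq_of_evalAt_eq hR (fun s hs => (hG s hs).1.mul (hA s hs)) (fun s _ => convergesAt_one s)
      fun s hs => by
        rw [evalAt_mul (hG s hs).1 (hA s hs), (hG s hs).2, evalAt_one]
        exact inv_mul_cancel₀ (h0 s hs)
  have hconst : constantCoeff A ≠ 0 := by
    simpa [evalAt_zero] using h0 0 (by simpa using hR)
  rw [← (PowerSeries.eq_inv_iff_mul_eq_one hconst).2 hGA]
  exact (hG t ht).1

end Holomorphic

section QExponentials

lemma eq_C_of_rescale_eq_self {R : Type*} [CommRing R] [IsDomain R] {c : R} {F : R⟦X⟧}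
    (hc : ∀ n, c ^ (n + 1) ≠ 1) (h : rescale c F = F) : F = C (coeff 0 F) := by
  ext n
  cases n with
  | zero => rw [coeff_zero_C]
  | succ n =>
    have hn : c ^ (n + 1) * coeff (n + 1) F = coeff (n + 1) F := by rw [← coeff_rescale, h]
    rw [coeff_C, if_neg n.succ_ne_zero]
    exact (mul_eq_zero.1 (by linear_combination hn)).resolve_left (sub_ne_zero.2 (hc n))

lemma qPoch_succ (a q : ℝ) (n : ℕ) : qPoch a q (n + 1) = qPoch a q n * (1 - a * q ^ n) :=
  Finset.prod_range_succ _ _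

lemma qPoch_succ' (a q : ℝ) (n : ℕ) : qPoch a q (n + 1) = (1 - a) * qPoch (a * q) q n := by
  rw [qPoch, Finset.prod_range_succ', pow_zero, mul_one, mul_comm, qPoch]
  simp only [pow_succ', mul_assoc]

variable {q : ℝ}

lemma one_sub_ofReal_pow_succ_ne_zero (hq0 : 0 < q) (hq1 : q < 1) (n : ℕ) :
    1 - (q : ℂ) ^ (n + 1) ≠ 0 := by
  exact_mod_cast (sub_pos.2 (pow_lt_one₀ hq0.le hq1 n.succ_ne_zero)).ne'

lemma coeff_zero_qExpSmall (q : ℝ) : coeff 0 (qExpSmall q) = 1 := by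
  rw [qExpSmall, coeff_mk]
  simp [qPoch]

lemma coeff_zero_qExpBig (q : ℝ) : coeff 0 (qExpBig q) = 1 := by
  rw [qExpBig, coeff_mk]
  simp [qPoch]

lemma coeff_succ_qExpSmall (q : ℝ) (n : ℕ) :
    coeff (n + 1) (qExpSmall q) = (1 - q) / (1 - (q : ℂ) ^ (n + 1)) * coeff n (qExpSmall q) := by
  have h : (1 - q) ^ (n + 1) / qPoch q q (n + 1) =
      (1 - q) / (1 - q ^ (n + 1)) * ((1 - q) ^ n / qPoch q q n) := by
    rw [qPoch_succ, ← pow_succ' q, div_mul_div_comm, ← pow_succ', mul_comm (qPoch q q n)]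
  simp only [qExpSmall, coeff_mk]
  exact_mod_cast h

lemma coeff_succ_qExpBig (q : ℝ) (n : ℕ) :
    coeff (n + 1) (qExpBig q) =
      (1 - q) * (q : ℂ) ^ n / (1 - (q : ℂ) ^ (n + 1)) * coeff n (qExpBig q) := by
  have h : q ^ ((n + 1) * (n + 1 - 1) / 2) * (1 - q) ^ (n + 1) / qPoch q q (n + 1) =
      (1 - q) * q ^ n / (1 - q ^ (n + 1)) *
        (q ^ (n * (n - 1) / 2) * (1 - q) ^ n / qPoch q q n) := by
    rw [qPoch_succ, ← pow_succ' q, div_mul_div_comm, Nat.triangle_succ]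
    ring
  simp only [qExpBig, coeff_mk]
  exact_mod_cast h

lemma rescale_qExpSmall (hq0 : 0 < q) (hq1 : q < 1) :
    rescale (q : ℂ) (qExpSmall q) = (1 - C (1 - (q : ℂ)) * X) * qExpSmall q := by
  ext n
  rw [sub_mul, one_mul, mul_assoc, map_sub, coeff_C_mul, coeff_rescale]
  cases n with
  | zero => rw [coeff_zero_X_mul, pow_zero, one_mul, mul_zero, sub_zero]
  | succ n =>
    have := one_sub_ofReal_pow_succ_ne_zero hq0 hq1 n
    rw [coeff_succ_X_mul, coeff_succ_qExpSmall]
    field_simp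
    ring

lemma qExpBig_eq_mul_rescale (hq0 : 0 < q) (hq1 : q < 1) :
    qExpBig q = (1 + C (1 - (q : ℂ)) * X) * rescale (q : ℂ) (qExpBig q) := by
  ext n
  rw [add_mul, one_mul, mul_assoc, map_add, coeff_C_mul, coeff_rescale]
  cases n with
  | zero => rw [coeff_zero_X_mul, pow_zero, one_mul, mul_zero, add_zero]
  | succ n =>
    have := one_sub_ofReal_pow_succ_ne_zero hq0 hq1 n
    rw [coeff_succ_X_mul, coeff_rescale, coeff_succ_qExpBig]
    field_simp
    ring

lemma qExpSmall_mul_rescale_neg_one_qExpBig (hq0 : 0 < q) (hq1 : q < 1) :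
    qExpSmall q * rescale (-1) (qExpBig q) = 1 := by
  have hconst (c : ℂ) : rescale (-1) (C c) = C c := by
    ext n
    cases n <;> simp [coeff_C, coeff_rescale]
  have hneg : rescale (-1) (qExpBig q) =
      (1 - C (1 - (q : ℂ)) * X) * rescale (q : ℂ) (rescale (-1) (qExpBig q)) := by
    conv_lhs => rw [qExpBig_eq_mul_rescale hq0 hq1]
    rw [map_mul, map_add, map_one, map_mul, rescale_X, rescale_rescale, rescale_rescale,
      mul_comm (-1 : ℂ)]
    simp [sub_eq_add_neg, hconst]
  have hfix : rescale (q : ℂ) (qExpSmall q * rescale (-1) (qExpBig q)) =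
      qExpSmall q * rescale (-1) (qExpBig q) := by
    conv_rhs => rw [hneg]
    rw [map_mul, rescale_qExpSmall hq0 hq1]
    ring
  rw [eq_C_of_rescale_eq_self
    (fun n => (sub_ne_zero.1 (one_sub_ofReal_pow_succ_ne_zero hq0 hq1 n)).symm) hfix]
  simp [coeff_zero_qExpSmall, coeff_zero_qExpBig, coeff_mul, -coeff_zero_eq_constantCoeff]

lemma coeff_succ_qExpSmall_mul_qExpBig (hq0 : 0 < q) (hq1 : q < 1) (n : ℕ) :
    coeff (n + 1) (qExpSmall q * qExpBig q) =
      (1 - q) * (1 + (q : ℂ) ^ n) / (1 - (q : ℂ) ^ (n + 1)) *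
        coeff n (qExpSmall q * qExpBig q) := by
  have hmul : (1 - C (1 - (q : ℂ)) * X) * (qExpSmall q * qExpBig q) =
      (1 + C (1 - (q : ℂ)) * X) * rescale (q : ℂ) (qExpSmall q * qExpBig q) := by
    conv_lhs => rw [qExpBig_eq_mul_rescale hq0 hq1]
    rw [map_mul, rescale_qExpSmall hq0 hq1]
    ring
  have hcoeff := congrArg (coeff (n + 1)) hmul
  rw [sub_mul, add_mul, one_mul, one_mul, mul_assoc, mul_assoc, map_sub, map_add, coeff_C_mul,
    coeff_C_mul, coeff_succ_X_mul, coeff_succ_X_mul, coeff_rescale, coeff_rescale] at hcoeff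
  rw [div_mul_eq_mul_div, eq_div_iff (one_sub_ofReal_pow_succ_ne_zero hq0 hq1 n)]
  linear_combination hcoeff

lemma coeff_qExpSmall_mul_qExpBig (hq0 : 0 < q) (hq1 : q < 1) (n : ℕ) :
    coeff n (qExpSmall q * qExpBig q) =
      ((qPoch (-1) q n / qPoch q q n * (1 - q) ^ n : ℝ) : ℂ) := by
  induction n with
  | zero =>
    simp [coeff_zero_qExpSmall, coeff_zero_qExpBig, coeff_mul, qPoch,
      -coeff_zero_eq_constantCoeff]
  | succ n ih =>
    have h : qPoch (-1) q (n + 1) / qPoch q q (n + 1) * (1 - q) ^ (n + 1) =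
        (1 - q) * (1 + q ^ n) / (1 - q ^ (n + 1)) *
          (qPoch (-1) q n / qPoch q q n * (1 - q) ^ n) := by
      rw [qPoch_succ, qPoch_succ, ← pow_succ' q, mul_div_mul_comm]
      ring
    rw [coeff_succ_qExpSmall_mul_qExpBig hq0 hq1, ih, h]
    push_cast
    rfl

lemma tendsto_ofReal_pow_atTop_nhds_zero (hq0 : 0 < q) (hq1 : q < 1) :
    Tendsto (fun n : ℕ => (q : ℂ) ^ n) atTop (𝓝 0) :=
  tendsto_pow_atTop_nhds_zero_of_norm_lt_one (by rwa [Complex.norm_of_nonneg hq0.le])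

lemma tendsto_one_sub_ofReal_pow_succ (hq0 : 0 < q) (hq1 : q < 1) :
    Tendsto (fun n : ℕ => 1 - (q : ℂ) ^ (n + 1)) atTop (𝓝 1) := by
  simpa only [sub_zero] using
    ((tendsto_add_atTop_iff_nat 1).2 (tendsto_ofReal_pow_atTop_nhds_zero hq0 hq1)).const_sub 1

lemma convergesAt_qExpBig (hq0 : 0 < q) (hq1 : q < 1) (t : ℂ) : ConvergesAt (qExpBig q) t := by
  refine convergesAt_of_coeff_succ (coeff_succ_qExpBig q)
    (((tendsto_ofReal_pow_atTop_nhds_zero hq0 hq1).const_mul _).div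
      (tendsto_one_sub_ofReal_pow_succ hq0 hq1) one_ne_zero) ?_
  rw [mul_zero, zero_div, zero_mul, norm_zero]
  exact one_pos

lemma convergesAt_qExpSmall_mul_qExpBig (hq0 : 0 < q) (hq1 : q < 1) {t : ℂ}
    (ht : (1 - q) * ‖t‖ < 1) : ConvergesAt (qExpSmall q * qExpBig q) t := by
  refine convergesAt_of_coeff_succ (coeff_succ_qExpSmall_mul_qExpBig hq0 hq1)
    ((((tendsto_ofReal_pow_atTop_nhds_zero hq0 hq1).const_add 1).const_mul _).div
      (tendsto_one_sub_ofReal_pow_succ hq0 hq1) one_ne_zero) ?_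
  rw [add_zero, mul_one, div_one, ← Complex.ofReal_one, ← Complex.ofReal_sub, norm_mul,
    Complex.norm_of_nonneg (sub_pos.2 hq1).le]
  exact ht

lemma evalAt_qExpSmall_mul_qExpBig_mul (hq0 : 0 < q) (hq1 : q < 1) {t : ℂ}
    (ht : (1 - q) * ‖t‖ < 1) :
    evalAt (qExpSmall q * qExpBig q) t * evalAt (qExpBig q) (-t) = evalAt (qExpBig q) t := by
  have hformal : qExpSmall q * qExpBig q * rescale (-1) (qExpBig q) = qExpBig q := by
    rw [mul_right_comm, qExpSmall_mul_rescale_neg_one_qExpBig hq0 hq1, one_mul]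
  rw [← neg_one_mul t, ← evalAt_rescale,
    ← evalAt_mul (convergesAt_qExpSmall_mul_qExpBig hq0 hq1 ht)
      (convergesAt_rescale.2 (convergesAt_qExpBig hq0 hq1 _)), hformal]

end QExponentials

section ZerosOfQSine

variable {q : ℝ}

lemma evalAt_qExpBig (hq0 : 0 < q) (hq1 : q < 1) (t : ℂ) :
    evalAt (qExpBig q) t = (1 + (1 - q) * t) * evalAt (qExpBig q) (q * t) := by
  have hconv : ConvergesAt (rescale (q : ℂ) (qExpBig q)) t :=
    convergesAt_rescale.2 (convergesAt_qExpBig hq0 hq1 _)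
  have hsub : qExpBig q - rescale (q : ℂ) (qExpBig q) =
      C (1 - (q : ℂ)) * (X * rescale (q : ℂ) (qExpBig q)) := by
    linear_combination qExpBig_eq_mul_rescale hq0 hq1
  have heval := evalAt_sub (convergesAt_qExpBig hq0 hq1 t) hconv
  rw [hsub, evalAt_C_mul, evalAt_X_mul hconv, evalAt_rescale] at heval
  linear_combination -heval

lemma evalAt_qExpBig_eq_prod_mul (hq0 : 0 < q) (hq1 : q < 1) (t : ℂ) (N : ℕ) :
    evalAt (qExpBig q) t =
      (∏ i ∈ Finset.range N, (1 + (1 - q) * q ^ i * t)) * evalAt (qExpBig q) (q ^ N * t) := by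
  induction N with
  | zero => rw [Finset.prod_range_zero, pow_zero, one_mul, one_mul]
  | succ N ih =>
    rw [ih, Finset.prod_range_succ, evalAt_qExpBig hq0 hq1 (q ^ N * t), pow_succ']
    ring_nf

lemma tendsto_prod_qExpBig (hq0 : 0 < q) (hq1 : q < 1) (t : ℂ) :
    Tendsto (fun N => ∏ i ∈ Finset.range N, (1 + (1 - q) * q ^ i * t)) atTop
      (𝓝 (evalAt (qExpBig q) t)) := by
  have htail : Tendsto (fun N : ℕ => evalAt (qExpBig q) (q ^ N * t)) atTop (𝓝 1) := by
    have hcont := continuousAt_evalAt_zero one_pos fun s _ => convergesAt_qExpBig hq0 hq1 s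
    rw [ContinuousAt, evalAt_zero, coeff_zero_qExpBig] at hcont
    refine hcont.comp ?_
    simpa only [zero_mul] using (tendsto_ofReal_pow_atTop_nhds_zero hq0 hq1).mul_const t
  have hquot := (tendsto_const_nhds (x := evalAt (qExpBig q) t)).div htail one_ne_zero
  rw [div_one] at hquot
  refine hquot.congr' ?_
  filter_upwards [htail.eventually_ne one_ne_zero] with N hN
  exact (eq_div_of_mul_eq hN (evalAt_qExpBig_eq_prod_mul hq0 hq1 t N).symm).symm

lemma one_le_norm_one_add {w : ℂ} (hw : 0 ≤ w.re) : 1 ≤ ‖1 + w‖ :=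
  calc (1 : ℝ) ≤ (1 + w).re := by simpa using hw
    _ ≤ ‖1 + w‖ := Complex.re_le_norm _

lemma norm_one_sub_lt_norm_one_add {w : ℂ} (hw : 0 < w.re) : ‖1 - w‖ < ‖1 + w‖ := by
  rw [← sq_lt_sq₀ (norm_nonneg _) (norm_nonneg _), ← Complex.normSq_eq_norm_sq,
    ← Complex.normSq_eq_norm_sq, Complex.normSq_sub, Complex.normSq_add]
  simp only [map_one, one_mul, Complex.conj_re]
  linarith

lemma re_one_sub_mul_pow_mul_pos (hq0 : 0 < q) (hq1 : q < 1) {t : ℂ} (ht : 0 < t.re) (i : ℕ) :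
    0 < ((1 - q) * q ^ i * t : ℂ).re := by
  have : ((1 - q) * q ^ i * t : ℂ).re = (1 - q) * q ^ i * t.re := by
    rw [← Complex.re_ofReal_mul]
    push_cast
    rfl
  rw [this]
  exact mul_pos (mul_pos (sub_pos.2 hq1) (by positivity)) ht

lemma one_le_norm_evalAt_qExpBig (hq0 : 0 < q) (hq1 : q < 1) {t : ℂ} (ht : 0 < t.re) :
    1 ≤ ‖evalAt (qExpBig q) t‖ := by
  refine ge_of_tendsto' (tendsto_prod_qExpBig hq0 hq1 t).norm fun N => ?_
  rw [norm_prod]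
  exact Finset.one_le_prod fun i _ =>
    one_le_norm_one_add (re_one_sub_mul_pow_mul_pos hq0 hq1 ht i).le

lemma norm_evalAt_qExpBig_neg_le (hq0 : 0 < q) (hq1 : q < 1) {t : ℂ} (ht : 0 < t.re) :
    ‖evalAt (qExpBig q) (-t)‖ ≤ ‖evalAt (qExpBig q) t‖ := by
  refine le_of_tendsto_of_tendsto' (tendsto_prod_qExpBig hq0 hq1 (-t)).norm
    (tendsto_prod_qExpBig hq0 hq1 t).norm fun N => ?_
  rw [norm_prod, norm_prod]
  refine Finset.prod_le_prod (fun _ _ => norm_nonneg _) fun i _ => ?_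
  rw [mul_neg, ← sub_eq_add_neg]
  exact (norm_one_sub_lt_norm_one_add (re_one_sub_mul_pow_mul_pos hq0 hq1 ht i)).le

lemma norm_evalAt_qExpBig_neg_lt (hq0 : 0 < q) (hq1 : q < 1) {t : ℂ} (ht : 0 < t.re) :
    ‖evalAt (qExpBig q) (-t)‖ < ‖evalAt (qExpBig q) t‖ := by
  have hqt : 0 < (q * t : ℂ).re := by
    rw [Complex.re_ofReal_mul]
    exact mul_pos hq0 ht
  have hfactor : ‖1 - (1 - q) * t‖ < ‖1 + (1 - q) * t‖ :=
    norm_one_sub_lt_norm_one_add (by simpa using re_one_sub_mul_pow_mul_pos hq0 hq1 ht 0)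
  calc ‖evalAt (qExpBig q) (-t)‖ = ‖1 - (1 - q) * t‖ * ‖evalAt (qExpBig q) (-(q * t))‖ := by
        rw [evalAt_qExpBig hq0 hq1, norm_mul, mul_neg, mul_neg, ← sub_eq_add_neg]
    _ ≤ ‖1 - (1 - q) * t‖ * ‖evalAt (qExpBig q) (q * t)‖ := by
        gcongr
        exact norm_evalAt_qExpBig_neg_le hq0 hq1 hqt
    _ < ‖1 + (1 - q) * t‖ * ‖evalAt (qExpBig q) (q * t)‖ := by
        gcongr
        exact one_pos.trans_le (one_le_norm_evalAt_qExpBig hq0 hq1 hqt)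
    _ = ‖evalAt (qExpBig q) t‖ := by rw [← norm_mul, ← evalAt_qExpBig hq0 hq1]

lemma re_eq_zero_of_evalAt_qExpBig_eq_neg (hq0 : 0 < q) (hq1 : q < 1) {t : ℂ}
    (h : evalAt (qExpBig q) t = evalAt (qExpBig q) (-t)) : t.re = 0 := by
  rcases lt_trichotomy t.re 0 with ht | ht | ht
  · have := norm_evalAt_qExpBig_neg_lt hq0 hq1 (t := -t) (by simpa using ht)
    rw [neg_neg, h] at this
    exact absurd this (lt_irrefl _)
  · exact ht
  · have := norm_evalAt_qExpBig_neg_lt hq0 hq1 ht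
    rw [h] at this
    exact absurd this (lt_irrefl _)

/-- Jackson's `q`-sine `Sin_q x = ∑_k (-1)^k q^{k(2k+1)} x^{2k+1}/(q;q)_{2k+1}`, which is
`(E_q(ix/(1-q)) - E_q(-ix/(1-q)))/(2i)` in the normalization of `E_q` used here. -/
noncomputable def qSine (q x : ℝ) : ℝ :=
  ∑' k : ℕ, (-1) ^ k * (q ^ ((2 * k + 1) * k) * x ^ (2 * k + 1) / qPoch q q (2 * k + 1))

lemma qSine_neg (q x : ℝ) : qSine q (-x) = -qSine q x := by
  simp only [qSine, (odd_two_mul_add_one _).neg_pow, mul_neg, neg_div, tsum_neg]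

lemma evalAt_qExpBig_sub_neg (hq0 : 0 < q) (hq1 : q < 1) (s : ℝ) :
    evalAt (qExpBig q) (Complex.I * s) - evalAt (qExpBig q) (-(Complex.I * s)) =
      2 * Complex.I * qSine q ((1 - q) * s) := by
  rw [← (hasSum_evalAt_sub_evalAt_neg (convergesAt_qExpBig hq0 hq1 _)).tsum_eq, qSine,
    Complex.ofReal_tsum, ← tsum_mul_left]
  refine tsum_congr fun k => ?_
  have hI : Complex.I ^ (2 * k + 1) = (-1) ^ k * Complex.I := by
    rw [pow_succ, pow_mul, Complex.I_sq]
  have hexp : (2 * k + 1) * (2 * k + 1 - 1) / 2 = (2 * k + 1) * k := by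
    rw [Nat.add_sub_cancel, mul_left_comm, Nat.mul_div_cancel_left _ two_pos]
  rw [qExpBig, coeff_mk, mul_pow, hI, hexp, mul_pow]
  push_cast
  ring

lemma qPoch_odd (q : ℝ) (k : ℕ) :
    qPoch q q (2 * k + 1) = (1 - q) * (qPoch (q ^ 2) (q ^ 2) k * qPoch (q ^ 3) (q ^ 2) k) := by
  induction k with
  | zero => simp [qPoch]
  | succ k ih =>
    rw [show 2 * (k + 1) + 1 = 2 * k + 1 + 1 + 1 by ring, qPoch_succ, qPoch_succ, ih, qPoch_succ,
      qPoch_succ]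
    ring

lemma sq_rpow (hq0 : 0 ≤ q) (x : ℝ) : (q ^ 2) ^ x = q ^ (2 * x) := by
  rw [Real.rpow_mul hq0, Real.rpow_two]

lemma sqrt_mul_jacksonBesselTwo_half (hq0 : 0 < q) (hq1 : q < 1) {x : ℝ} (hx : 0 < x) :
    √x * jacksonBesselTwo (1 / 2) (q ^ 2) (2 * x) =
      qPochInf (q ^ 3) (q ^ 2) / qPochInf (q ^ 2) (q ^ 2) * (1 - q) * qSine q x := by
  have hbase : (q ^ 2) ^ ((1 / 2 : ℝ) + 1) = q ^ 3 := by
    rw [sq_rpow hq0.le, ← Real.rpow_natCast]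
    norm_num
  rw [jacksonBesselTwo, hbase, mul_left_comm, mul_assoc, qSine, ← tsum_mul_left (a := √x),
    ← tsum_mul_left (a := 1 - q)]
  congr 1
  refine tsum_congr fun k => ?_
  have hq : (q ^ 2) ^ ((k : ℝ) * (1 / 2 + k)) = q ^ ((2 * k + 1) * k) := by
    rw [sq_rpow hq0.le, ← Real.rpow_natCast]
    push_cast
    ring_nf
  have hpow : √x * x ^ (2 * (k : ℝ) + 1 / 2) = x ^ (2 * k + 1) := by
    rw [Real.sqrt_eq_rpow, ← Real.rpow_add hx, ← Real.rpow_natCast]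
    push_cast
    ring_nf
  have hc : 1 - q ≠ 0 := (sub_pos.2 hq1).ne'
  rw [hq, mul_div_cancel_left₀ x two_ne_zero, qPoch_odd, ← hpow]
  field_simp

lemma firstZeroBesselTwo_half_le_of_qSine_eq_zero (hq0 : 0 < q) (hq1 : q < 1) {x : ℝ}
    (hx : x ≠ 0) (h : qSine q x = 0) : firstZeroBesselTwo (1 / 2) q ≤ 2 * |x| := by
  have habs : qSine q |x| = 0 := by
    rcases abs_choice x with hx' | hx' <;> rw [hx']
    · exact h
    · rw [qSine_neg, h, neg_zero]
  refine csInf_le ⟨0, fun y hy => hy.1.le⟩ ⟨by positivity, ?_⟩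
  have hmul := sqrt_mul_jacksonBesselTwo_half hq0 hq1 (abs_pos.2 hx)
  rw [habs, mul_zero] at hmul
  exact (mul_eq_zero.1 hmul).resolve_left (Real.sqrt_pos.2 (abs_pos.2 hx)).ne'

lemma firstZeroBesselTwo_half_le (hq0 : 0 < q) (hq1 : q < 1) {t : ℂ} (ht : t ≠ 0)
    (h : evalAt (qExpBig q) t = evalAt (qExpBig q) (-t)) :
    firstZeroBesselTwo (1 / 2) q ≤ 2 * ((1 - q) * ‖t‖) := by
  have hc : 0 < 1 - q := sub_pos.2 hq1
  obtain ⟨s, rfl⟩ : ∃ s : ℝ, t = Complex.I * s :=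
    ⟨t.im, by apply Complex.ext <;> simp [re_eq_zero_of_evalAt_qExpBig_eq_neg hq0 hq1 h]⟩
  have hs : s ≠ 0 := by simpa using ht
  have hsine : qSine q ((1 - q) * s) = 0 := by
    have := evalAt_qExpBig_sub_neg hq0 hq1 s
    rw [h, sub_self, eq_comm, mul_eq_zero] at this
    exact_mod_cast this.resolve_left (mul_ne_zero two_ne_zero Complex.I_ne_zero)
  have hle := firstZeroBesselTwo_half_le_of_qSine_eq_zero hq0 hq1 (mul_ne_zero hc.ne' hs) hsine
  rwa [norm_mul, Complex.norm_I, one_mul, Complex.norm_real, Real.norm_eq_abs, ← abs_of_pos hc,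
    ← abs_mul]

end ZerosOfQSine

section QBernoulliGeneratingFunction

variable {q : ℝ}

lemma coeff_qBernoulliDenomDivX (hq0 : 0 < q) (hq1 : q < 1) (m : ℕ) :
    coeff m (qBernoulliDenomDivX q) =
      ((qPoch (-q) q m / qPoch (q ^ 2) q m * ((1 - q) / 2) ^ m : ℝ) : ℂ) := by
  have hc : 1 - q ≠ 0 := (sub_pos.2 hq1).ne'
  have h : (1 / 2) ^ (m + 1) *
      (qPoch (-1) q (m + 1) / qPoch q q (m + 1) * (1 - q) ^ (m + 1)) =
      qPoch (-q) q m / qPoch (q ^ 2) q m * ((1 - q) / 2) ^ m := by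
    rw [qPoch_succ', qPoch_succ', neg_one_mul, ← sq, pow_succ, pow_succ, div_pow, div_pow,
      one_pow]
    field_simp
    ring
  rw [qBernoulliDenomDivX, coeff_mk, qBernoulliDenom, ← map_mul, map_sub, coeff_rescale, coeff_one,
    if_neg m.succ_ne_zero, sub_zero, coeff_qExpSmall_mul_qExpBig hq0 hq1, ← h]
  push_cast
  rfl

lemma one_sub_mul_norm_half_lt_one (hq1 : q < 1) {t : ℂ} (ht : ‖t‖ < 2 / (1 - q)) :
    (1 - q) * ‖1 / 2 * t‖ < 1 := by
  rw [lt_div_iff₀ (sub_pos.2 hq1)] at ht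
  rw [norm_mul, norm_div, norm_one, Complex.norm_ofNat]
  linarith

lemma X_mul_qBernoulliDenomDivX_eq_rescale (q : ℝ) :
    X * qBernoulliDenomDivX q = rescale (1 / 2) (qExpSmall q * qExpBig q) - 1 := by
  rw [X_mul_qBernoulliDenomDivX, qBernoulliDenom, map_mul]

lemma convergesAt_rescale_qExpSmall_mul_qExpBig (hq0 : 0 < q) (hq1 : q < 1) {t : ℂ}
    (ht : ‖t‖ < 2 / (1 - q)) :
    ConvergesAt (rescale (1 / 2) (qExpSmall q * qExpBig q)) t :=
  convergesAt_rescale.2 <| convergesAt_qExpSmall_mul_qExpBig hq0 hq1 <|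
    one_sub_mul_norm_half_lt_one hq1 ht

lemma convergesAt_qBernoulliDenomDivX (hq0 : 0 < q) (hq1 : q < 1) {t : ℂ}
    (ht : ‖t‖ < 2 / (1 - q)) : ConvergesAt (qBernoulliDenomDivX q) t := by
  rw [← convergesAt_X_mul, X_mul_qBernoulliDenomDivX_eq_rescale]
  exact (convergesAt_rescale_qExpSmall_mul_qExpBig hq0 hq1 ht).sub (convergesAt_one t)

lemma mul_evalAt_qBernoulliDenomDivX (hq0 : 0 < q) (hq1 : q < 1) {t : ℂ}
    (ht : ‖t‖ < 2 / (1 - q)) :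
    t * evalAt (qBernoulliDenomDivX q) t = evalAt (qExpSmall q * qExpBig q) (1 / 2 * t) - 1 := by
  rw [← evalAt_X_mul (convergesAt_qBernoulliDenomDivX hq0 hq1 ht),
    X_mul_qBernoulliDenomDivX_eq_rescale,
    evalAt_sub (convergesAt_rescale_qExpSmall_mul_qExpBig hq0 hq1 ht) (convergesAt_one t),
    evalAt_rescale, evalAt_one]

lemma evalAt_qBernoulliDenomDivX_ne_zero (hq0 : 0 < q) (hq1 : q < 1) {t : ℂ}
    (ht : ‖t‖ < min (2 / (1 - q)) (firstZeroBesselTwo (1 / 2) q / (1 - q))) :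
    evalAt (qBernoulliDenomDivX q) t ≠ 0 := by
  obtain ⟨hpole, hzero⟩ := lt_min_iff.1 ht
  rcases eq_or_ne t 0 with rfl | ht0
  · rw [evalAt_zero, coeff_zero_eq_constantCoeff_apply, constantCoeff_qBernoulliDenomDivX hq1]
    exact one_ne_zero
  intro h
  have hone : evalAt (qExpSmall q * qExpBig q) (1 / 2 * t) = 1 := by
    have := mul_evalAt_qBernoulliDenomDivX hq0 hq1 hpole
    rwa [h, mul_zero, eq_comm, sub_eq_zero] at this
  have hE := evalAt_qExpSmall_mul_qExpBig_mul hq0 hq1 (one_sub_mul_norm_half_lt_one hq1 hpole)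
  rw [hone, one_mul] at hE
  have hle := firstZeroBesselTwo_half_le hq0 hq1 (mul_ne_zero (by norm_num) ht0) hE.symm
  rw [lt_div_iff₀ (sub_pos.2 hq1)] at hzero
  rw [norm_mul, norm_div, norm_one, Complex.norm_ofNat] at hle
  linarith

lemma convergesAt_qBernoulliGen (hq0 : 0 < q) (hq1 : q < 1) (z : ℂ) {t : ℂ}
    (ht : ‖t‖ < min (2 / (1 - q)) (firstZeroBesselTwo (1 / 2) q / (1 - q))) :
    ConvergesAt (qBernoulliGen q z) t :=
  (convergesAt_rescale.2 (convergesAt_qExpBig hq0 hq1 _)).mul <|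
    convergesAt_inv
      (fun _ hs => convergesAt_qBernoulliDenomDivX hq0 hq1 (hs.trans_le (min_le_left _ _)))
      (fun _ hs => evalAt_qBernoulliDenomDivX_ne_zero hq0 hq1 hs) ht

lemma qBernoulliGen_mul (hq1 : q < 1) (z : ℂ) :
    qBernoulliGen q z * qBernoulliDenomDivX q = rescale z (qExpBig q) := by
  rw [qBernoulliGen, mul_assoc, PowerSeries.inv_mul_cancel, mul_one]
  rw [constantCoeff_qBernoulliDenomDivX hq1]
  exact one_ne_zero

end QBernoulliGeneratingFunction

section Rearrangement

lemma isBigO_pow_of_tendsto_root {E : Type*} [SeminormedAddCommGroup E] {u : ℕ → E} {τ ρ : ℝ}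
    (hτ : τ < ρ) (h : Tendsto (fun n : ℕ => ‖u n‖ ^ (1 / (n : ℝ))) atTop (𝓝 τ)) :
    u =O[atTop] fun n => ρ ^ n := by
  refine Asymptotics.IsBigO.of_bound' ?_
  filter_upwards [h.eventually_lt_const hτ, eventually_ne_atTop 0] with n hn hn0
  calc ‖u n‖ = (‖u n‖ ^ (1 / (n : ℝ))) ^ n := by
        rw [one_div, Real.rpow_inv_natCast_pow (norm_nonneg _) hn0]
    _ ≤ ρ ^ n := by gcongr
    _ ≤ ‖ρ ^ n‖ := Real.le_norm_self _

variable {𝕜 : Type*} [NormedField 𝕜] {u : ℕ → 𝕜} {r : 𝕜} {B D : 𝕜⟦X⟧}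

lemma exists_norm_le_mul_norm_pow (hr : r ≠ 0) (hu : u =O[atTop] fun n => r ^ n) :
    ∃ K : ℝ, ∀ n, ‖u n‖ ≤ K * ‖r‖ ^ n := by
  obtain ⟨K, -, hK⟩ := Asymptotics.bound_of_isBigO_nat_atTop hu
  exact ⟨K, fun n => by simpa only [norm_pow] using hK (pow_ne_zero n hr)⟩

lemma summable_mul_coeff_mul_coeff [CompleteSpace 𝕜] (hr : r ≠ 0)
    (hu : u =O[atTop] fun n => r ^ n) (hB : ConvergesAt B r) (hD : ConvergesAt D r) :
    Summable fun p : ℕ × ℕ => u (p.1 + p.2) * (coeff p.1 B * coeff p.2 D) := by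
  obtain ⟨K, hK⟩ := exists_norm_le_mul_norm_pow hr hu
  refine Summable.of_norm_bounded (((Summable.mul_of_nonneg hB hD (fun _ => norm_nonneg _)
    fun _ => norm_nonneg _)).mul_left K) fun p => ?_
  simp only [norm_mul, norm_pow]
  calc ‖u (p.1 + p.2)‖ * (‖coeff p.1 B‖ * ‖coeff p.2 D‖)
      ≤ K * ‖r‖ ^ (p.1 + p.2) * (‖coeff p.1 B‖ * ‖coeff p.2 D‖) := by
        gcongr
        exact hK _
    _ = K * (‖coeff p.1 B‖ * ‖r‖ ^ p.1 * (‖coeff p.2 D‖ * ‖r‖ ^ p.2)) := by ring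

lemma summable_shift_mul_coeff [CompleteSpace 𝕜] (hr : r ≠ 0)
    (hu : u =O[atTop] fun n => r ^ n) (hD : ConvergesAt D r) (n : ℕ) :
    Summable fun m => u (n + m) * coeff m D := by
  obtain ⟨K, hK⟩ := exists_norm_le_mul_norm_pow hr hu
  refine Summable.of_norm_bounded (Summable.mul_left (K * ‖r‖ ^ n) hD) fun m => ?_
  rw [norm_mul, norm_mul, norm_pow]
  calc ‖u (n + m)‖ * ‖coeff m D‖ ≤ K * ‖r‖ ^ (n + m) * ‖coeff m D‖ := by
        gcongr
        exact hK _
    _ = K * ‖r‖ ^ n * (‖coeff m D‖ * ‖r‖ ^ m) := by ring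

lemma hasSum_tsum_mul_coeff [CompleteSpace 𝕜] (hr : r ≠ 0) (hu : u =O[atTop] fun n => r ^ n)
    (hB : ConvergesAt B r) (hD : ConvergesAt D r) {s : 𝕜}
    (hs : HasSum (fun k => u k * coeff k (B * D)) s) :
    HasSum (fun n => (∑' m, u (n + m) * coeff m D) * coeff n B) s := by
  have hsum := (summable_mul_coeff_mul_coeff hr hu hB hD).hasSum
  have hdiag : HasSum (fun k => u k * coeff k (B * D))
      (∑' p : ℕ × ℕ, u (p.1 + p.2) * (coeff p.1 B * coeff p.2 D)) := by
    refine ((Finset.HasAntidiagonal.sigmaAntidiagonalEquivProd (A := ℕ)).hasSum_iff.2 hsum).sigma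
      fun k => ?_
    rw [coeff_mul, Finset.mul_sum, ← Finset.sum_coe_sort]
    refine (hasSum_fintype _).congr_fun fun p => ?_
    simp [← Finset.HasAntidiagonal.mem_antidiagonal.1 p.2]
  rw [hs.unique hdiag]
  refine hsum.prod_fiberwise fun n => ?_
  have := ((summable_shift_mul_coeff hr hu hD n).mul_right (coeff n B)).hasSum
  rw [tsum_mul_right] at this
  exact this.congr_fun fun m => by rw [mul_assoc, mul_comm (coeff n B)]

end Rearrangement

section QBernoulliExpansion

variable {q : ℝ}

lemma qFact_eq_div (q : ℝ) (n : ℕ) : qFact q n = qPoch q q n / (1 - q) ^ n := by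
  simp only [qFact, qNat, qPoch, Finset.prod_div_distrib, Finset.prod_const, Finset.card_range,
    pow_succ']

lemma coeff_qExpBig (q : ℝ) (n : ℕ) : coeff n (qExpBig q) = (qPsi q n : ℂ) := by
  rw [qExpBig, coeff_mk, qPsi, qFact_eq_div, div_div_eq_mul_div]

lemma qPsi_ne_zero (hq0 : 0 < q) (hq1 : q < 1) (n : ℕ) : (qPsi q n : ℂ) ≠ 0 := by
  exact_mod_cast (div_pos (pow_pos hq0 _) (qFact_pos hq0 hq1 n)).ne'

lemma qBernoulli_div_qFact (hq0 : 0 < q) (hq1 : q < 1) (n : ℕ) (z : ℂ) :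
    qBernoulli q n z / qFact q n = coeff n (qBernoulliGen q z) := by
  rw [qBernoulli, mul_div_cancel_left₀]
  exact_mod_cast (qFact_pos hq0 hq1 n).ne'

lemma qBernoulliCoeffTerm_eq (hq0 : 0 < q) (hq1 : q < 1) (a : ℕ → ℂ) (n m : ℕ) :
    qBernoulliCoeffTerm q a n m = (((1 - q) ^ n : ℝ) : ℂ) *
      (a (n + m) / qPsi q (n + m) * coeff m (qBernoulliDenomDivX q)) := by
  have hc : 1 - q ≠ 0 := (sub_pos.2 hq1).ne'
  have hreal : (q ^ ((n + m) * (n + m - 1) / 2))⁻¹ * qPoch q q (n + m) *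
      qPoch (-q) q m * (1 / 2) ^ m / qPoch (q ^ 2) q m =
      (1 - q) ^ n * ((qPsi q (n + m))⁻¹ *
        (qPoch (-q) q m / qPoch (q ^ 2) q m * ((1 - q) / 2) ^ m)) := by
    rw [qPsi, qFact_eq_div, div_pow, div_pow, pow_add (1 - q)]
    field_simp
    simp
  rw [qBernoulliCoeffTerm, coeff_qBernoulliDenomDivX hq0 hq1, hreal]
  push_cast
  ring

lemma qBernoulliCoeff_eq (hq0 : 0 < q) (hq1 : q < 1) (a : ℕ → ℂ) (n : ℕ) :
    qBernoulliCoeff q a n =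
      ∑' m, a (n + m) / qPsi q (n + m) * coeff m (qBernoulliDenomDivX q) := by
  have hc : (((1 - q) ^ n : ℝ) : ℂ) ≠ 0 := by
    exact_mod_cast (pow_pos (sub_pos.2 hq1) n).ne'
  simp only [qBernoulliCoeff, qBernoulliCoeffTerm_eq hq0 hq1]
  rw [tsum_mul_left, Complex.ofReal_inv, inv_mul_cancel_left₀ hc]

end QBernoulliExpansion

theorem corollary4p7_general (q : ℝ) (hq0 : 0 < q) (hq1 : q < 1)
    (f : ℂ → ℂ) (a : ℕ → ℂ) (hf : ∀ z : ℂ, HasSum (fun n : ℕ => a n * z ^ n) (f z))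
    (ρ : ℝ) (hρ0 : 0 < ρ)
    (hρ1 : ρ < min (2 / (1 - q)) (firstZeroBesselTwo (1 / 2) q / (1 - q)))
    (hgrowth : (fun n : ℕ => a n / (qPsi q n : ℂ)) =O[atTop] fun n => ρ ^ n) :
    (∀ n : ℕ, Summable (fun m : ℕ => qBernoulliCoeffTerm q a n m)) ∧
    ∀ z : ℂ, HasSum (fun n : ℕ => qBernoulliCoeff q a n * (qBernoulli q n z / (qFact q n : ℂ)))
      (f z) := by
  have hρ : (ρ : ℂ) ≠ 0 := Complex.ofReal_ne_zero.2 hρ0.ne'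
  have hnorm : ‖(ρ : ℂ)‖ = ρ := Complex.norm_of_nonneg hρ0.le
  have hu : (fun n => a n / (qPsi q n : ℂ)) =O[atTop] fun n => (ρ : ℂ) ^ n :=
    hgrowth.trans (Asymptotics.isBigO_of_le _ fun n => by simp)
  have hD : ConvergesAt (qBernoulliDenomDivX q) ρ :=
    convergesAt_qBernoulliDenomDivX hq0 hq1 (by rw [hnorm]; exact hρ1.trans_le (min_le_left _ _))
  refine ⟨fun n => ?_, fun z => ?_⟩
  · simp only [qBernoulliCoeffTerm_eq hq0 hq1]
    exact (summable_shift_mul_coeff hρ hu hD n).mul_left _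
  · have hB : ConvergesAt (qBernoulliGen q z) ρ :=
      convergesAt_qBernoulliGen hq0 hq1 z (by rwa [hnorm])
    simp only [qBernoulliCoeff_eq hq0 hq1, qBernoulli_div_qFact hq0 hq1]
    refine hasSum_tsum_mul_coeff hρ hu hB hD ((hf z).congr_fun fun k => ?_)
    rw [qBernoulliGen_mul hq1, coeff_rescale, coeff_qExpBig, mul_left_comm, mul_comm,
      div_mul_cancel₀ _ (qPsi_ne_zero hq0 hq1 k)]

theorem corollary4p7 (q : ℝ) (hq0 : 0 < q) (hq1 : q < 1)
    (f : ℂ → ℂ) (a : ℕ → ℂ) (hf : ∀ z : ℂ, HasSum (fun n : ℕ => a n * z ^ n) (f z))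
    (τ : ℝ) (hτ0 : 0 ≤ τ)
    (hτ1 : τ < min (2 / (1 - q)) (firstZeroBesselTwo (1 / 2) q / (1 - q)))
    (hgrowth : Tendsto (fun n : ℕ => ‖a n / (qPsi q n : ℂ)‖ ^ (1 / (n : ℝ))) atTop (𝓝 τ)) :
    (∀ n : ℕ, Summable (fun m : ℕ => qBernoulliCoeffTerm q a n m)) ∧
    ∀ z : ℂ, HasSum (fun n : ℕ => qBernoulliCoeff q a n * (qBernoulli q n z / (qFact q n : ℂ)))
      (f z) := by
  obtain ⟨ρ, hτρ, hρ1⟩ := exists_between hτ1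
  exact corollary4p7_general q hq0 hq1 f a hf ρ (hτ0.trans_lt hτρ) hρ1
    (isBigO_pow_of_tendsto_root hτρ hgrowth)
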